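/- **Setting.** Let $2\le N\le k$ be integers and let $K$ be a compact metric space. Let $\pi:\{1,\dots,k\}^{\{1,2,3,\dots\}}\to K$ be continuous and onto (product topology), and let $\psi_1,\dots,\psi_k:K\to K$ be continuous one-to-one maps with $\psi_i(\pi(i_1,i_2,\dots))=\pi(i,i_1,i_2,\dots)$. For a finite word $w=(i_1,\dots,i_m)$ put $|w|=m$, $\psi_w=\psi_{i_1}\circ\cdots\circ\psi_{i_m}$, $K_w=\psi_w(K)$. Suppose that each $\psi_i$ has a unique fixed point $P_i$, that $V^{(0)}=\{P_1,\dots,P_N\}$ has $N$ elements, and, writing $V_w=\psi_w(V^{(0)})$ and $V^{(m)}=\bigcup_{|w|=m}V_w$, $V^{(\infty)}=\bigcup_m V^{(m)}$, that * if $w\ne w'$ and $|w|=|w'|$, then $K_w\cap K_{w'}=V_w\cap V_{w'}$, and this set has at most one element; * if $\psi_i(P_j)=P_h$ with $1\le i\le k$ and $1\le j,h\le N$, then $i=j=h$; * any two points of $V^{(1)}$ are joined by a finite sequence of points of $V^{(1)}$ in which any two consecutive points lie in a common $V_i$, $1\le i\le k$. **Polyratios.** A polyratio is $\alpha=(\alpha_1,\dots,\alpha_k)$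 with all $\alpha_i\in\,]0,1[$; put $\alpha_w=\alpha_{i_1}\cdots\alpha_{i_m}$, with $\alpha_\emptyset=1$. It is a *metric polyratio* on $K$ if there is a distance $d$ on $K$ (not required to induce the given topology) for which every $\psi_i$ is $\alpha_i$-Lipschitz. It is an *asymptotic metric polyratio* on $K$ if there are a distance $d$ on $K$ of finite diameter and constants $c_1,c_2>0$ such that $c_1\alpha_w\,\mathrm{diam}_d(K)\le \mathrm{diam}_d(K_w)\le c_2\alpha_w\,\mathrm{diam}_d(K)$ for every finite word $w$. **Paths.** Let $\widehat J=\{(j_1,j_2):1\le j_1,j_2\le N,\ j_1\neq j_2\}$, and for $\iota=(j_1,j_2)\in\widehat J$ put $P_\iota=(P_{j_1},P_{j_2})$ and $\psi_w(P_\iota)=(\psi_w(P_{j_1}),\psi_w(P_{j_2}))$. A *path* is a finite sequence $\Pi=(Q_0,\dots,Q_n)$ in $V^{(\infty)}$, $n=n(\Pi)\ge 0$, such that for each $h=1,\dots,n$ we have $(Q_{h-1},Q_h)=\psi_w(P_\iota)$ for some finite word $w=:\widetilde w(h,\Pi)$ and some $\iota=:\widetilde\iota(h,\Pi)\in\widehat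 J$ (these are unique). Put $\Sigma_\Pi(\alpha)=\sum_{h=1}^{n}\alpha_{\widetilde w(h,\Pi)}$. The path is *strict* if the $Q_h$ are all different, and *strong* if $\widetilde w(h,\Pi)\ne\emptyset$ for every $h$. It is an *$\iota$-path* if $(Q_0,Q_n)=P_\iota$, and a *$V^{(1)}$-path* if all $Q_h\in V^{(1)}$; a *$(\iota,V^{(1)})$-path* is both. Put $\psi_w(\Pi)=(\psi_w(Q_0),\dots,\psi_w(Q_n))$. A *subpath* of $\Pi$ is $(Q_a,Q_{a+1},\dots,Q_b)$ with $0\le a\le b\le n$. A *multisubpath* of $\Pi$ is a finite sequence of subpaths $(Q_{a_\beta},\dots,Q_{b_\beta})$ with $a_\beta<b_\beta$ for which the intervals $]a_\beta,b_\beta]$ are mutually disjoint. A *refinement* of $\Pi$ is a sequence $(Q_{h_0},\dots,Q_{h_l})$ with $0=h_0<h_1<\dots<h_l=n$ and $Q_{h_{i+1}}=Q_{h_i+1}$ for $i=0,\dots,l-1$. **Theorem 6.3.** Assume that there are finitely many paths $\Pi_1,\dots,\Pi_r$ and pairs $\iota_1,\dots,\iota_r\in\widehat J$ such that: * (i) for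 every $s$, $\Pi_s$ is a strict and strong $(\iota_s,V^{(1)})$-path, and $\widetilde\iota(h,\Pi_s)=\iota_s$ for every $h$; * (ii) there is $\widetilde m\in\mathbb N$ such that every path $\Pi$ that connects two different points of $V^{(0)}$ and satisfies $|\widetilde w(h,\Pi)|\ge\widetilde m$ for all $h$ contains a subpath of the form $\psi_w(\overline\Pi)$, where $|w|=\widetilde m$ and $\overline\Pi$ is an $\iota_s$-path for some $s$; * (iii) for every $s$ and every strong $\iota_s$-path $\Pi$ there are $s'\in\{1,\dots,r\}$ and a multisubpath $(\widehat\Pi_1,\dots,\widehat\Pi_{n(\Pi_{s'})})$ of $\Pi$ such that each $\widehat\Pi_\beta$ has a refinement of the form $\psi_{\widetilde w(\beta,\Pi_{s'})}(\widehat\Pi''_\beta)$, where $\widehat\Pi''_\beta$ is an $\iota_{s(\beta)}$-path for some $s(\beta)\in\{1,\dots,r\}$. Then, for every polyratio $\alpha$, $\alpha$ is a metric polyratio on $K$ if and only if $\Sigma_{\Pi_s}(\alpha)\ge 1$ for every $s=1,\dots,r$; and likewise $\alpha$ is an asymptotic metric polyratio on $K$ if and only if $\Sigma_{\Pi_s}(\alpha)\ge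 1$ for every $s=1,\dots,r$. -/

import Mathlib

universe u

/-! ### Words -/

/-- The infinite word `iw`, obtained from the infinite word `w` by writing the letter `i` in front. -/
def consWord {k : ℕ} (i : Fin k) (w : ℕ → Fin k) : ℕ → Fin k
  | 0 => i
  | n + 1 => w n

/-- `ψ_w = ψ_{i_1} ∘ ⋯ ∘ ψ_{i_m}` for a finite word `w = (i_1, …, i_m)`. -/
def wordMap {k : ℕ} {K : Type u} (ψ : Fin k → K → K) : List (Fin k) → K → K
  | [] => id
  | i :: w => ψ i ∘ wordMap ψ w

/-- `α_w = α_{i_1} ⋯ α_{i_m}` for a finite word `w = (i_1, …, i_m)`; it is `1` for the empty word. -/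
def wordRatio {k : ℕ} (α : Fin k → ℝ) (w : List (Fin k)) : ℝ := (w.map α).prod

/-- The set of ordered pairs of distinct indices in `{1, …, N}`. -/
abbrev IndexPair (N : ℕ) : Type := {p : Fin N × Fin N // p.1 ≠ p.2}

/-! ### The class of fractals -/

/-- The finitely ramified (P.C.F.) self-similar fractals `K` with `k` maps and `N` boundary points. -/
structure SelfSimilarFractal (k N : ℕ) (K : Type u) [MetricSpace K] [CompactSpace K] where
  /-- the coding map from the space of infinite words onto `K` -/
  π : (ℕ → Fin k) → K
  π_continuous : Continuous π
  π_surjective : Function.Surjective π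
  /-- the maps `ψ_1, …, ψ_k` -/
  ψ : Fin k → K → K
  ψ_continuous : ∀ i, Continuous (ψ i)
  ψ_injective : ∀ i, Function.Injective (ψ i)
  ψ_π : ∀ i w, ψ i (π w) = π (consWord i w)
  /-- `P i` is the unique fixed point of `ψ i` -/
  P : Fin k → K
  fixed_iff : ∀ i x, ψ i x = x ↔ x = P i
  two_le : 2 ≤ N
  le_k : N ≤ k
  /-- `V⁽⁰⁾ = {P_1, …, P_N}` has `N` elements -/
  P_injective : Function.Injective fun j : Fin N => P (Fin.castLE le_k j)
  /-- different copies of the same level meet only at points of the corresponding cells -/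
  inter_eq : ∀ w w' : List (Fin k), w ≠ w' → w.length = w'.length →
    Set.range (wordMap ψ w) ∩ Set.range (wordMap ψ w') =
      (Set.range fun j : Fin N => wordMap ψ w (P (Fin.castLE le_k j))) ∩
        (Set.range fun j : Fin N => wordMap ψ w' (P (Fin.castLE le_k j)))
  /-- different copies of the same level have at most one common point -/
  inter_subsingleton : ∀ w w' : List (Fin k), w ≠ w' → w.length = w'.length →
    (Set.range (wordMap ψ w) ∩ Set.range (wordMap ψ w')).Subsingleton
  /-- if `ψ_i(P_j) = P_h` with `j, h ≤ N` then `i = j = h` -/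
  map_P : ∀ (i : Fin k) (j h : Fin N),
    ψ i (P (Fin.castLE le_k j)) = P (Fin.castLE le_k h) → i = Fin.castLE le_k j ∧ j = h
  /-- any two points of `V⁽¹⁾` are joined by a finite sequence of points of `V⁽¹⁾` in which any
  two consecutive points lie in a common `1`-cell -/
  connected : ∀ Q Q' : K,
    (∃ (i : Fin k) (j : Fin N), Q = ψ i (P (Fin.castLE le_k j))) →
    (∃ (i : Fin k) (j : Fin N), Q' = ψ i (P (Fin.castLE le_k j))) →
    ∃ (n : ℕ) (q : ℕ → K), q 0 = Q ∧ q n = Q' ∧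
      (∀ h ≤ n, ∃ (i : Fin k) (j : Fin N), q h = ψ i (P (Fin.castLE le_k j))) ∧
      ∀ h < n, ∃ (i : Fin k) (j j' : Fin N),
        q h = ψ i (P (Fin.castLE le_k j)) ∧ q (h + 1) = ψ i (P (Fin.castLE le_k j'))

/-! ### Finite sequences of points -/

/-- A finite sequence `(Q_0, …, Q_n)`; the values of `pt` at indices larger than `n` are irrelevant
(no definition below looks at them). -/
structure PointSeq (K : Type u) where
  n : ℕ
  pt : ℕ → K

namespace PointSeq

variable {K : Type u}

/-- `(Q_a, Q_{a+1}, …, Q_b)`, used for `a ≤ b ≤ n`. -/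
def sub (p : PointSeq K) (a b : ℕ) : PointSeq K := ⟨b - a, fun h => p.pt (a + h)⟩

/-- `(f(Q_0), …, f(Q_n))`. -/
def map (f : K → K) (p : PointSeq K) : PointSeq K := ⟨p.n, fun h => f (p.pt h)⟩

/-- Equality of finite sequences. -/
def Same (p q : PointSeq K) : Prop := p.n = q.n ∧ ∀ h ≤ p.n, p.pt h = q.pt h

/-- The sequence connects `Q` to `Q'`. -/
def Connects (p : PointSeq K) (Q Q' : K) : Prop := p.pt 0 = Q ∧ p.pt p.n = Q'

/-- All the points of the sequence are different. -/
def Strict (p : PointSeq K) : Prop := ∀ h ≤ p.n, ∀ h' ≤ p.n, h ≠ h' → p.pt h ≠ p.pt h'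

/-- `p'` is a refinement of `p = (Q_0, …, Q_n)`: it has the form `(Q_{h_0}, …, Q_{h_s})` with
`0 = h_0 < h_1 < ⋯ < h_s = n` and `Q_{h_{l+1}} = Q_{h_l + 1}` for `l = 0, …, s - 1`. -/
def IsRefinement (p' p : PointSeq K) : Prop :=
  ∃ h : ℕ → ℕ, h 0 = 0 ∧ h p'.n = p.n ∧
    (∀ l < p'.n, h l < h (l + 1) ∧ p.pt (h (l + 1)) = p.pt (h l + 1)) ∧
    ∀ l ≤ p'.n, p'.pt l = p.pt (h l)

/-- The sum `Σ_p(f) = ∑ f(Q_{h-1}, Q_h)` over the edges of the sequence. -/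
def edgeSum (p : PointSeq K) (f : K → K → ℝ) : ℝ :=
  ∑ h ∈ Finset.range p.n, f (p.pt h) (p.pt (h + 1))

end PointSeq

namespace SelfSimilarFractal

variable {k N : ℕ} {K : Type u} [MetricSpace K] [CompactSpace K]

/-! ### Cells, copies, and the graph on `V⁽∞⁾` -/

/-- The map `ψ_w`. -/
def wmap (F : SelfSimilarFractal k N K) (w : List (Fin k)) : K → K := wordMap F.ψ w

/-- The boundary points `P_1, …, P_N`. -/
def bd (F : SelfSimilarFractal k N K) (j : Fin N) : K := F.P (Fin.castLE F.le_k j)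

/-- `V⁽⁰⁾ = {P_1, …, P_N}`. -/
def V0 (F : SelfSimilarFractal k N K) : Set K := Set.range F.bd

/-- `V⁽ᵐ⁾`, the union of the `m`-cells `ψ_w(V⁽⁰⁾)`, `|w| = m`. -/
def V (F : SelfSimilarFractal k N K) (m : ℕ) : Set K :=
  {Q | ∃ w : List (Fin k), w.length = m ∧ Q ∈ F.wmap w '' F.V0}

/-- `V⁽∞⁾`, the union of all `V⁽ᵐ⁾`. -/
def Vinf (F : SelfSimilarFractal k N K) : Set K := ⋃ m, F.V m

/-- The copy `K_w = ψ_w(K)`. -/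
def copy (F : SelfSimilarFractal k N K) (w : List (Fin k)) : Set K := Set.range (F.wmap w)

/-- `(Q, Q') = ψ_w(P_ι) = (ψ_w(P_{j_1}), ψ_w(P_{j_2}))` where `ι = (j_1, j_2)`. -/
def IsRep (F : SelfSimilarFractal k N K) (Q Q' : K) (w : List (Fin k)) (ι : IndexPair N) : Prop :=
  Q = F.wmap w (F.bd ι.1.1) ∧ Q' = F.wmap w (F.bd ι.1.2)

/-- The adjacency `Q ∼ Q'`. -/
def Adj (F : SelfSimilarFractal k N K) (Q Q' : K) : Prop := ∃ w ι, F.IsRep Q Q' w ι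

open Classical in
/-- The word `w` of the representation `(Q, Q') = ψ_w(P_ι)` of an edge; `w` and `ι` are
unique (`IsRep.unique`). -/
noncomputable def word (F : SelfSimilarFractal k N K) (Q Q' : K) : List (Fin k) :=
  if h : F.Adj Q Q' then h.choose else []

/-- The function with value `α_w` at the edge `(Q, Q') = ψ_w(P_ι)`. -/
noncomputable def edgeRatio (F : SelfSimilarFractal k N K) (α : Fin k → ℝ) (Q Q' : K) : ℝ :=
  wordRatio α (F.word Q Q')

theorem wmap_injective (F : SelfSimilarFractal k N K) (w : List (Fin k)) :
    Function.Injective (F.wmap w) := by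
  induction w with
  | nil => exact Function.injective_id
  | cons i w ih => exact (F.ψ_injective i).comp ih

theorem bd_injective (F : SelfSimilarFractal k N K) : Function.Injective F.bd := F.P_injective

theorem eq_of_ψ_eq_bd (F : SelfSimilarFractal k N K) {i : Fin k} {x : K} {j : Fin N}
    (h : F.ψ i x = F.bd j) : i = Fin.castLE F.le_k j := by
  by_contra hne
  have hfix : F.ψ (Fin.castLE F.le_k j) (F.bd j) = F.bd j := (F.fixed_iff _ _).2 rfl
  have hmem : F.bd j ∈ Set.range (wordMap F.ψ [i]) ∩
      Set.range (wordMap F.ψ [Fin.castLE F.le_k j]) := ⟨⟨x, h⟩, ⟨F.bd j, hfix⟩⟩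
  rw [F.inter_eq [i] [Fin.castLE F.le_k j] (by simpa using hne) rfl] at hmem
  obtain ⟨⟨j', hj'⟩, -⟩ := hmem
  obtain ⟨h1, h2⟩ := F.map_P i j' j hj'
  exact hne (by rw [h1, h2])

theorem IsRep.ne {F : SelfSimilarFractal k N K} {Q Q' : K} {w : List (Fin k)} {ι : IndexPair N}
    (h : F.IsRep Q Q' w ι) : Q ≠ Q' := by
  intro he
  rw [h.1, h.2] at he
  exact ι.2 (F.bd_injective (F.wmap_injective w he))

theorem not_isRep_nil_cons {F : SelfSimilarFractal k N K} {Q Q' : K} {i : Fin k}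
    {w : List (Fin k)} {ι ι' : IndexPair N} (h : F.IsRep Q Q' [] ι)
    (h' : F.IsRep Q Q' (i :: w) ι') : False := by
  have h1 := F.eq_of_ψ_eq_bd (h'.1.symm.trans h.1)
  have h2 := F.eq_of_ψ_eq_bd (h'.2.symm.trans h.2)
  exact ι.2 (Fin.castLE_injective F.le_k (h1.symm.trans h2))

/-- Each edge `(Q, Q')` has only one representation as `ψ_w(P_ι)`. -/
theorem IsRep.unique {F : SelfSimilarFractal k N K} {w w' : List (Fin k)} {ι ι' : IndexPair N}
    {Q Q' : K} (h : F.IsRep Q Q' w ι) (h' : F.IsRep Q Q' w' ι') : w = w' ∧ ι = ι' := by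
  induction w generalizing w' Q Q' with
  | nil =>
    cases w' with
    | nil =>
      refine ⟨rfl, Subtype.ext (Prod.ext ?_ ?_)⟩
      · exact F.bd_injective (h.1.symm.trans h'.1)
      · exact F.bd_injective (h.2.symm.trans h'.2)
    | cons i' w' => exact (not_isRep_nil_cons h h').elim
  | cons i w ih =>
    cases w' with
    | nil => exact (not_isRep_nil_cons h' h).elim
    | cons i' w' =>
      by_cases hi : i = i'
      · subst hi
        obtain ⟨h1, h2⟩ := ih (w' := w') ⟨rfl, rfl⟩
          ⟨F.ψ_injective i (h.1.symm.trans h'.1), F.ψ_injective i (h.2.symm.trans h'.2)⟩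
        exact ⟨by rw [h1], h2⟩
      · refine (h.ne ?_).elim
        exact F.inter_subsingleton [i] [i'] (by simpa using hi) rfl
          ⟨⟨_, h.1.symm⟩, ⟨_, h'.1.symm⟩⟩ ⟨⟨_, h.2.symm⟩, ⟨_, h'.2.symm⟩⟩

/-- The word of an edge `(Q, Q') = ψ_w(P_ι)` is `w`. -/
theorem IsRep.word_eq {F : SelfSimilarFractal k N K} {w : List (Fin k)} {ι : IndexPair N}
    {Q Q' : K} (h : F.IsRep Q Q' w ι) : F.word Q Q' = w := by
  have hadj : F.Adj Q Q' := ⟨w, ι, h⟩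
  obtain ⟨ι', hι'⟩ := hadj.choose_spec
  rw [word, dif_pos hadj]
  exact (hι'.unique h).1

/-! ### Paths -/

/-- A path: a finite sequence of points of `V⁽∞⁾`, consecutive ones being adjacent. -/
def IsPath (F : SelfSimilarFractal k N K) (p : PointSeq K) : Prop :=
  (∀ h ≤ p.n, p.pt h ∈ F.Vinf) ∧ ∀ h < p.n, F.Adj (p.pt h) (p.pt (h + 1))

/-- An `ι`-path: a path from `P_{j_1}` to `P_{j_2}`, where `ι = (j_1, j_2)`. -/
def IsPathFor (F : SelfSimilarFractal k N K) (ι : IndexPair N) (p : PointSeq K) : Prop :=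
  F.IsPath p ∧ p.Connects (F.bd ι.1.1) (F.bd ι.1.2)

/-- Strong: the word of each edge is nonempty. -/
def Strong (F : SelfSimilarFractal k N K) (p : PointSeq K) : Prop :=
  ∀ h < p.n, F.word (p.pt h) (p.pt (h + 1)) ≠ []

/-- The intervals `]a_β, b_β]`, `β = 1, …, l`, define a multisubpath of `p`, namely the sequence of
the subpaths `(Q_{a_β}, …, Q_{b_β})`: these have length greater than `1` and no common edge. -/
def IsMultiSubpath (p : PointSeq K) {l : ℕ} (a b : Fin l → ℕ) : Prop :=
  (∀ β, a β < b β ∧ b β ≤ p.n) ∧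
    ∀ β β', β ≠ β' → Disjoint (Set.Ioc (a β) (b β)) (Set.Ioc (a β') (b β'))

/-! ### The structural conditions on the paths `Π_1, …, Π_r` -/

/-- Condition (i): `Π_s` is a strict and strong `(ι_s, V⁽¹⁾)`-path, and all its edges
are of the form `ψ_w(P_{ι_s})`. -/
def CondI (F : SelfSimilarFractal k N K) {r : ℕ} (Pi : Fin r → PointSeq K)
    (ι : Fin r → IndexPair N) : Prop :=
  ∀ s, F.IsPathFor (ι s) (Pi s) ∧ (∀ h ≤ (Pi s).n, (Pi s).pt h ∈ F.V 1) ∧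
    (Pi s).Strict ∧ F.Strong (Pi s) ∧
    ∀ h < (Pi s).n, F.IsRep ((Pi s).pt h) ((Pi s).pt (h + 1))
      (F.word ((Pi s).pt h) ((Pi s).pt (h + 1))) (ι s)

/-- Condition (ii): for some `m`, each path connecting two different points of `V⁽⁰⁾` whose
edges all have words of length at least `m` has a subpath `ψ_w(q)`, where `|w| = m` and `q` is an
`ι_s`-path for some `s`. -/
def CondII (F : SelfSimilarFractal k N K) {r : ℕ} (ι : Fin r → IndexPair N) : Prop :=
  ∃ m : ℕ, ∀ (p : PointSeq K) (Q Q' : K), F.IsPath p → Q ∈ F.V0 → Q' ∈ F.V0 → Q ≠ Q' →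
    p.Connects Q Q' → (∀ h < p.n, m ≤ (F.word (p.pt h) (p.pt (h + 1))).length) →
    ∃ (a b : ℕ) (s : Fin r) (w : List (Fin k)) (q : PointSeq K), a ≤ b ∧ b ≤ p.n ∧
      w.length = m ∧ F.IsPathFor (ι s) q ∧ (p.sub a b).Same (q.map (F.wmap w))

/-- Condition (iii): for each strong `ι_s`-path `p` there are an index `s'` and a multisubpath
`(p_1, …, p_l)` of `p`, with one member for each edge of `Π_{s'}`, such that each `p_β` has
a refinement of the form `ψ_w(q)`, where `w` is the word of the `β`-th edge of `Π_{s'}` and `q`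
is an `ι_t`-path for some `t = s(β)`. -/
def CondIII (F : SelfSimilarFractal k N K) {r : ℕ} (Pi : Fin r → PointSeq K)
    (ι : Fin r → IndexPair N) : Prop :=
  ∀ (s : Fin r) (p : PointSeq K), F.IsPathFor (ι s) p → F.Strong p →
    ∃ (s' : Fin r) (a b : Fin (Pi s').n → ℕ), IsMultiSubpath p a b ∧
      ∀ β : Fin (Pi s').n, ∃ (p' q : PointSeq K) (t : Fin r),
        p'.IsRefinement (p.sub (a β) (b β)) ∧ F.IsPathFor (ι t) q ∧
        p'.Same (q.map (F.wmap (F.word ((Pi s').pt β) ((Pi s').pt (β + 1)))))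

end SelfSimilarFractal

/-! ### Distances and polyratios -/

/-- `d` is a distance on `X`. -/
structure IsDistance {X : Type u} (d : X → X → ℝ) : Prop where
  eq_zero_iff : ∀ x y, d x y = 0 ↔ x = y
  symm : ∀ x y, d x y = d y x
  triangle : ∀ x y z, d x z ≤ d x y + d y z

/-- The diameter of `E` with respect to `d`, meaningful when `d` is bounded on `E`. -/
noncomputable def distDiam {X : Type u} (d : X → X → ℝ) (E : Set X) : ℝ :=
  sSup {t | ∃ x ∈ E, ∃ y ∈ E, t = d x y}

/-- A polyratio: numbers `α_1, …, α_k` in `]0, 1[`. -/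
def IsPolyratio {k : ℕ} (α : Fin k → ℝ) : Prop := ∀ i, 0 < α i ∧ α i < 1

namespace SelfSimilarFractal

variable {k N : ℕ} {K : Type u} [MetricSpace K] [CompactSpace K]

/-- The distance `d` is `α`-self-similar: each `ψ_i` is `α_i`-Lipschitz. -/
def IsSelfSimilarDist (F : SelfSimilarFractal k N K) (α : Fin k → ℝ) (d : K → K → ℝ) : Prop :=
  IsDistance d ∧ ∀ i x y, d (F.ψ i x) (F.ψ i y) ≤ α i * d x y

/-- The distance `d` is `α`-scaling: it is bounded, and `diam(K_w)` lies between
`c₁ α_w diam(K)` and `c₂ α_w diam(K)` for every finite word `w`. -/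
def IsScalingDist (F : SelfSimilarFractal k N K) (α : Fin k → ℝ) (d : K → K → ℝ) : Prop :=
  IsDistance d ∧ (∃ C : ℝ, ∀ x y, d x y ≤ C) ∧
    ∃ c₁ c₂ : ℝ, 0 < c₁ ∧ 0 < c₂ ∧ ∀ w : List (Fin k),
      c₁ * wordRatio α w * distDiam d Set.univ ≤ distDiam d (F.copy w) ∧
      distDiam d (F.copy w) ≤ c₂ * wordRatio α w * distDiam d Set.univ

/-- `α` is a metric polyratio on the fractal. -/
def IsMetricPolyratio (F : SelfSimilarFractal k N K) (α : Fin k → ℝ) : Prop :=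
  ∃ d, F.IsSelfSimilarDist α d

/-- `α` is an asymptotic metric polyratio on the fractal. -/
def IsAsMetricPolyratio (F : SelfSimilarFractal k N K) (α : Fin k → ℝ) : Prop :=
  ∃ d, F.IsScalingDist α d

end SelfSimilarFractal

/-! Necessity is a contraction argument. Both kinds of distance satisfy `d (ψ_w P_ι) ≤ C α_w` for
all words `w`. All edges of `Π_s` have type `ι_s`, so replacing an edge by a copy of `Π_s` improves
`C` to `C S`, where `S` is the sum of `Π_s`. If `S < 1`, iteration makes two distinct boundary
points have distance `0` (`one_le_edgeSum_of_dist_le`).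

For sufficiency, one distance serves both claims: `chainDist`, the infimum of `∑ α_w` over chains of
cells joining two points. Symmetry, the triangle inequality and the Lipschitz bounds hold for every
polyratio; only positivity is at stake. Condition (iii) shows, by induction on word length, that
every `ι_s`-path has sum at least `1` (`CondIII.one_le_edgeSum`), and (ii) turns this into a lower
bound `c > 0` for paths between any two boundary points (`CondII.exists_le_edgeSum`). Non-nested
cells meet only at common vertices, so a chain between boundary points can be pruned to a path that
costs no more (`ChainCost.le_of_forall_path`); hence boundary points are at `chainDist` at least
`c`.

For arbitrary points, a cheap chain cannot cross an `m`-cell from one vertex to another, so it ends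
in an `m`-cell meeting the one where it started (`ChainCost.exists_cell`). As cells shrink
uniformly, distinct points have positive distance. The lower scaling bound comes from chains that
must leave `K_w` through a vertex (`ChainCost.wordRatio_mul_le`). -/

section WordRatio

variable {k : ℕ} {α : Fin k → ℝ}

/-! ### Ratios of words. -/

theorem wordRatio_nil (α : Fin k → ℝ) : wordRatio α [] = 1 := rfl

theorem wordRatio_cons (α : Fin k → ℝ) (i : Fin k) (w : List (Fin k)) :
    wordRatio α (i :: w) = α i * wordRatio α w := by
  simp [wordRatio]

theorem wordRatio_append (α : Fin k → ℝ) (v w : List (Fin k)) :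
    wordRatio α (v ++ w) = wordRatio α v * wordRatio α w := by
  simp [wordRatio]

theorem IsPolyratio.wordRatio_pos (hα : IsPolyratio α) (w : List (Fin k)) :
    0 < wordRatio α w := by
  induction w with
  | nil => exact one_pos
  | cons i w ih => rw [wordRatio_cons]; exact mul_pos (hα i).1 ih

theorem IsPolyratio.wordRatio_le_one (hα : IsPolyratio α) (w : List (Fin k)) :
    wordRatio α w ≤ 1 := by
  induction w with
  | nil => exact le_rfl
  | cons i w ih =>
    rw [wordRatio_cons]
    exact mul_le_one₀ (hα i).2.le (hα.wordRatio_pos w).le ih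

theorem IsPolyratio.wordRatio_le_of_prefix (hα : IsPolyratio α) {v w : List (Fin k)}
    (h : v <+: w) : wordRatio α w ≤ wordRatio α v := by
  obtain ⟨u, rfl⟩ := h
  rw [wordRatio_append]
  exact mul_le_of_le_one_right (hα.wordRatio_pos v).le (hα.wordRatio_le_one u)

theorem IsPolyratio.exists_lower_bound (hα : IsPolyratio α) :
    ∃ a : ℝ, 0 < a ∧ a ≤ 1 ∧ ∀ i, a ≤ α i := by
  rcases isEmpty_or_nonempty (Fin k) with h | h
  · exact ⟨1, one_pos, le_rfl, fun i => h.elim i⟩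
  · obtain ⟨i, hi⟩ := Finite.exists_min α
    exact ⟨α i, (hα i).1, (hα i).2.le, hi⟩

theorem pow_length_le_wordRatio {a : ℝ} (ha : 0 < a) (h : ∀ i, a ≤ α i) (w : List (Fin k)) :
    a ^ w.length ≤ wordRatio α w := by
  induction w with
  | nil => simp [wordRatio_nil]
  | cons i w ih =>
    rw [wordRatio_cons, List.length_cons, pow_succ']
    exact mul_le_mul (h i) ih (by positivity) (ha.le.trans (h i))

theorem pow_le_wordRatio {a : ℝ} (ha : 0 < a) (ha1 : a ≤ 1) (h : ∀ i, a ≤ α i)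
    {w : List (Fin k)} {m : ℕ} (hw : w.length ≤ m) : a ^ m ≤ wordRatio α w :=
  (pow_le_pow_of_le_one ha.le ha1 hw).trans (pow_length_le_wordRatio ha h w)

end WordRatio

/-! ### Edge sums of subpaths, multisubpaths and refinements. -/

namespace PointSeq

variable {K : Type u}

/-- The `l`-th edge of the refinement is the edge of `p` that starts at index `h_l`; these indices
strictly increase, so no edge is counted twice. -/
theorem edgeSum_le_of_isRefinement {p' p : PointSeq K} (h : p'.IsRefinement p) {f : K → K → ℝ}
    (hf : ∀ x y, 0 ≤ f x y) : p'.edgeSum f ≤ p.edgeSum f := by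
  obtain ⟨i, hi0, hin, hi, hpt⟩ := h
  have hmono : ∀ l' ≤ p'.n, ∀ l < l', i l < i l' := by
    intro l'
    induction l' with
    | zero => intro _ l hl; omega
    | succ l' ih =>
      intro hl' l hl
      rcases Nat.lt_succ_iff_lt_or_eq.1 hl with h | rfl
      · exact (ih (by omega) l h).trans (hi l' hl').1
      · exact (hi l hl').1
  have hinj : Set.InjOn i (Finset.range p'.n) := by
    intro l hl l' hl' he
    simp only [Finset.coe_range, Set.mem_Iio] at hl hl'
    rcases lt_trichotomy l l' with h | h | h
    · exact absurd he (hmono l' hl'.le l h).ne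
    · exact h
    · exact absurd he (hmono l hl.le l' h).ne'
  have h1 : p'.edgeSum f = ∑ j ∈ (Finset.range p'.n).image i, f (p.pt j) (p.pt (j + 1)) := by
    rw [Finset.sum_image hinj]
    refine Finset.sum_congr rfl fun l hl => ?_
    have hl := Finset.mem_range.1 hl
    rw [hpt l hl.le, hpt (l + 1) hl, (hi l hl).2]
  rw [h1]
  refine Finset.sum_le_sum_of_subset_of_nonneg ?_ fun _ _ _ => hf _ _
  intro j hj
  obtain ⟨l, hl, rfl⟩ := Finset.mem_image.1 hj
  rw [Finset.mem_range, ← hin]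
  exact hmono _ le_rfl l (Finset.mem_range.1 hl)

/-- The edges of a refinement are edges of the sequence. -/
theorem IsRefinement.exists_edge {p' p : PointSeq K} (h : p'.IsRefinement p) {l : ℕ}
    (hl : l < p'.n) : ∃ j < p.n, p'.pt l = p.pt j ∧ p'.pt (l + 1) = p.pt (j + 1) := by
  obtain ⟨i, hi0, hin, hi, hpt⟩ := h
  refine ⟨i l, ?_, hpt l hl.le, by rw [hpt (l + 1) hl, (hi l hl).2]⟩
  have h1 := (hi l hl).1
  have h2 : ∀ d, l + 1 + d ≤ p'.n → i (l + 1) ≤ i (l + 1 + d) := by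
    intro d
    induction d with
    | zero => intro _; exact le_rfl
    | succ d ih => intro hd; exact (ih (by omega)).trans (hi (l + 1 + d) (by omega)).1.le
  have h3 := h2 (p'.n - (l + 1)) (by omega)
  rw [show l + 1 + (p'.n - (l + 1)) = p'.n by omega, hin] at h3
  omega

theorem edgeSum_sub (p : PointSeq K) (a b : ℕ) (f : K → K → ℝ) :
    (p.sub a b).edgeSum f = ∑ h ∈ Finset.Ico a b, f (p.pt h) (p.pt (h + 1)) := by
  rw [Finset.sum_Ico_eq_sum_range]
  rfl

theorem edgeSum_sub_le (p : PointSeq K) {a b : ℕ} (hb : b ≤ p.n) {f : K → K → ℝ}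
    (hf : ∀ x y, 0 ≤ f x y) : (p.sub a b).edgeSum f ≤ p.edgeSum f := by
  rw [edgeSum_sub]
  refine Finset.sum_le_sum_of_subset_of_nonneg ?_ fun _ _ _ => hf _ _
  intro h hh
  have := Finset.mem_Ico.1 hh
  exact Finset.mem_range.2 (by omega)

theorem sum_edgeSum_sub_le {p : PointSeq K} {l : ℕ} {a b : Fin l → ℕ}
    (h : SelfSimilarFractal.IsMultiSubpath p a b) {f : K → K → ℝ} (hf : ∀ x y, 0 ≤ f x y) :
    ∑ β, (p.sub (a β) (b β)).edgeSum f ≤ p.edgeSum f := by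
  simp only [edgeSum_sub]
  rw [← Finset.sum_biUnion]
  · refine Finset.sum_le_sum_of_subset_of_nonneg ?_ fun _ _ _ => hf _ _
    intro j hj
    obtain ⟨β, -, hβ⟩ := Finset.mem_biUnion.1 hj
    have h1 := Finset.mem_Ico.1 hβ
    have h2 := (h.1 β).2
    exact Finset.mem_range.2 (by omega)
  · intro β _ β' _ hne
    refine Finset.disjoint_left.2 fun j hj hj' => ?_
    have h1 := Finset.mem_Ico.1 hj
    have h2 := Finset.mem_Ico.1 hj'
    -- The edge from `Q_j` to `Q_{j+1}` is labelled by its right end, hence the shift from `Ico` to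
    -- `Ioc`.
    have h3 : j + 1 ∈ Set.Ioc (a β) (b β) := ⟨by omega, by omega⟩
    have h4 : j + 1 ∈ Set.Ioc (a β') (b β') := ⟨by omega, by omega⟩
    exact Set.disjoint_left.1 (h.2 β β' hne) h3 h4

theorem le_edgeSum (p : PointSeq K) {f : K → K → ℝ} (hf : ∀ x y, 0 ≤ f x y) {h : ℕ}
    (hh : h < p.n) : f (p.pt h) (p.pt (h + 1)) ≤ p.edgeSum f :=
  Finset.single_le_sum (f := fun h => f (p.pt h) (p.pt (h + 1))) (fun _ _ => hf _ _)
    (Finset.mem_range.2 hh)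

theorem Same.edgeSum_eq {p q : PointSeq K} (h : p.Same q) (f : K → K → ℝ) :
    p.edgeSum f = q.edgeSum f := by
  unfold edgeSum
  rw [← h.1]
  refine Finset.sum_congr rfl fun j hj => ?_
  have := Finset.mem_range.1 hj
  rw [h.2 j (by omega), h.2 (j + 1) (by omega)]

end PointSeq

/-! ### Abstract distances and diameters. -/

theorem IsDistance.self_eq_zero {X : Type u} {d : X → X → ℝ} (hd : IsDistance d) (x : X) :
    d x x = 0 := (hd.eq_zero_iff x x).2 rfl

theorem IsDistance.nonneg {X : Type u} {d : X → X → ℝ} (hd : IsDistance d) (x y : X) :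
    0 ≤ d x y := by
  have h1 := hd.triangle x y x
  rw [hd.self_eq_zero, hd.symm y x] at h1
  linarith

theorem IsDistance.le_edgeSum {X : Type u} {d : X → X → ℝ} (hd : IsDistance d)
    (p : PointSeq X) : d (p.pt 0) (p.pt p.n) ≤ p.edgeSum d := by
  have : ∀ n, d (p.pt 0) (p.pt n) ≤ ∑ h ∈ Finset.range n, d (p.pt h) (p.pt (h + 1)) := by
    intro n
    induction n with
    | zero => simp [hd.self_eq_zero]
    | succ n ih =>
      rw [Finset.sum_range_succ]
      exact (hd.triangle _ (p.pt n) _).trans (by linarith)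
  exact this p.n

theorem le_distDiam {X : Type u} {d : X → X → ℝ} {C : ℝ} (hC : ∀ x y, d x y ≤ C) {E : Set X}
    {x y : X} (hx : x ∈ E) (hy : y ∈ E) : d x y ≤ distDiam d E :=
  le_csSup ⟨C, by rintro t ⟨x, -, y, -, rfl⟩; exact hC x y⟩ ⟨x, hx, y, hy, rfl⟩

theorem distDiam_le {X : Type u} {d : X → X → ℝ} {C : ℝ} {E : Set X} (hE : E.Nonempty)
    (hC : ∀ x ∈ E, ∀ y ∈ E, d x y ≤ C) : distDiam d E ≤ C := by
  obtain ⟨x, hx⟩ := hE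
  refine csSup_le ⟨_, x, hx, x, hx, rfl⟩ ?_
  rintro t ⟨x, hx, y, hy, rfl⟩
  exact hC x hx y hy

namespace SelfSimilarFractal

variable {k N : ℕ} {K : Type u} [MetricSpace K] [CompactSpace K] {F : SelfSimilarFractal k N K}
  {α : Fin k → ℝ}

/-! ### Cells and their vertices -/

theorem wmap_append (F : SelfSimilarFractal k N K) (v w : List (Fin k)) (x : K) :
    F.wmap (v ++ w) x = F.wmap v (F.wmap w x) := by
  induction v with
  | nil => rfl
  | cons i v ih => exact congrArg (F.ψ i) ih

theorem wmap_cons (F : SelfSimilarFractal k N K) (i : Fin k) (w : List (Fin k)) (x : K) :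
    F.wmap (i :: w) x = F.ψ i (F.wmap w x) := rfl

theorem copy_subset_of_prefix (F : SelfSimilarFractal k N K) {v w : List (Fin k)}
    (h : v <+: w) : F.copy w ⊆ F.copy v := by
  obtain ⟨u, rfl⟩ := h
  rintro _ ⟨x, rfl⟩
  exact ⟨F.wmap u x, (F.wmap_append v u x).symm⟩

/-- The only `1`-cell containing `P_j` is `K_j`, and `ψ_j` fixes `P_j`; so each letter of `w` can be
stripped off. -/
theorem eq_bd_of_wmap_eq_bd (F : SelfSimilarFractal k N K) {w : List (Fin k)} {x : K} {j : Fin N}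
    (h : F.wmap w x = F.bd j) : x = F.bd j := by
  induction w with
  | nil => exact h
  | cons i w ih =>
    have hi := F.eq_of_ψ_eq_bd (i := i) h
    subst hi
    refine ih (F.ψ_injective (Fin.castLE F.le_k j) ?_)
    rw [← wmap_cons, h]
    exact ((F.fixed_iff _ _).2 rfl).symm

/-- A vertex of a cell remains a vertex of every subcell containing it. With
`mem_vertices_of_length_eq` this passes from words of equal length to arbitrary incomparable words.
-/
theorem mem_vertices_append (F : SelfSimilarFractal k N K) {v w : List (Fin k)} {z : K}
    (h : z ∈ F.wmap v '' F.V0) (hz : z ∈ F.copy (v ++ w)) : z ∈ F.wmap (v ++ w) '' F.V0 := by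
  obtain ⟨_, ⟨j, rfl⟩, rfl⟩ := h
  obtain ⟨x, hx⟩ := hz
  rw [wmap_append] at hx
  have hj := F.wmap_injective v hx
  have := F.eq_bd_of_wmap_eq_bd hj
  subst this
  exact ⟨_, ⟨j, rfl⟩, by rw [wmap_append, hj]⟩

theorem mem_vertices_of_mem_V0 (F : SelfSimilarFractal k N K) {w : List (Fin k)} {z : K}
    (h : z ∈ F.V0) (hz : z ∈ F.copy w) : z ∈ F.wmap w '' F.V0 :=
  F.mem_vertices_append (v := []) ⟨z, h, rfl⟩ hz

theorem mem_vertices_of_length_eq (F : SelfSimilarFractal k N K) {v w : List (Fin k)} {z : K}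
    (hne : v ≠ w) (hl : v.length = w.length) (hv : z ∈ F.copy v) (hw : z ∈ F.copy w) :
    z ∈ F.wmap v '' F.V0 ∧ z ∈ F.wmap w '' F.V0 := by
  have h : z ∈ Set.range (wordMap F.ψ v) ∩ Set.range (wordMap F.ψ w) := ⟨hv, hw⟩
  rw [F.inter_eq v w hne hl] at h
  obtain ⟨⟨i, hi⟩, ⟨j, hj⟩⟩ := h
  exact ⟨⟨_, ⟨i, rfl⟩, hi⟩, ⟨_, ⟨j, rfl⟩, hj⟩⟩

theorem mem_vertices_of_not_prefix (F : SelfSimilarFractal k N K) {v w : List (Fin k)} {z : K}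
    (h1 : ¬ v <+: w) (h2 : ¬ w <+: v) (hv : z ∈ F.copy v) (hw : z ∈ F.copy w) :
    z ∈ F.wmap v '' F.V0 ∧ z ∈ F.wmap w '' F.V0 := by
  -- Incomparable words already differ after truncation to their common length.
  set l := min v.length w.length with hl
  have hne : v.take l ≠ w.take l := by
    intro he
    rcases le_total v.length w.length with h | h
    · rw [min_eq_left h] at hl
      rw [hl, List.take_length] at he
      exact h1 (he ▸ List.take_prefix _ _)
    · rw [min_eq_right h] at hl
      rw [hl, List.take_length] at he
      exact h2 (he ▸ List.take_prefix _ _)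
  have hlen : (v.take l).length = (w.take l).length := by
    simp only [List.length_take]; omega
  obtain ⟨h3, h4⟩ := F.mem_vertices_of_length_eq hne hlen
    (F.copy_subset_of_prefix (List.take_prefix l v) hv)
    (F.copy_subset_of_prefix (List.take_prefix l w) hw)
  have h5 := F.mem_vertices_append (w := v.drop l) h3
  have h6 := F.mem_vertices_append (w := w.drop l) h4
  rw [List.take_append_drop] at h5 h6
  exact ⟨h5 hv, h6 hw⟩

theorem exists_notMem_V0 (F : SelfSimilarFractal k N K) : ∃ x, x ∉ F.V0 := by
  have h2 := F.two_le
  have hk := F.le_k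
  refine ⟨F.ψ ⟨0, by omega⟩ (F.bd ⟨1, by omega⟩), ?_⟩
  rintro ⟨j, hj⟩
  have h := (F.map_P _ _ _ hj.symm).1
  simp [Fin.ext_iff] at h

/-- The diameter of the cells tends to `0` uniformly as their level increases. -/
theorem exists_forall_dist_lt (F : SelfSimilarFractal k N K) {ε : ℝ} (hε : 0 < ε) :
    ∃ m : ℕ, ∀ w : List (Fin k), w.length = m → ∀ x ∈ F.copy w, ∀ y ∈ F.copy w,
      dist x y < ε := by
  -- Uniform continuity of the coding map, obtained from a finite cover of the compact word space by
  -- cylinders.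
  have hloc : ∀ σ : ℕ → Fin k, ∃ m, ∀ τ, (∀ i < m, τ i = σ i) →
      dist (F.π τ) (F.π σ) < ε / 2 := by
    intro σ
    have ho : IsOpen (F.π ⁻¹' Metric.ball (F.π σ) (ε / 2)) :=
      Metric.isOpen_ball.preimage F.π_continuous
    obtain ⟨v, ⟨σ', m, rfl⟩, hσ, hv⟩ :=
      (PiNat.isTopologicalBasis_cylinders (fun _ => Fin k)).exists_subset_of_mem_open
        (Metric.mem_ball_self (half_pos hε) : σ ∈ F.π ⁻¹' Metric.ball (F.π σ) (ε / 2)) ho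
    refine ⟨m, fun τ hτ => hv ?_⟩
    intro i hi
    rw [hτ i hi, hσ i hi]
  choose m hm using hloc
  obtain ⟨s, hs⟩ := isCompact_univ.elim_finite_subcover
    (fun σ : ℕ → Fin k => PiNat.cylinder σ (m σ)) (fun σ => PiNat.isOpen_cylinder _ σ _)
    (fun σ _ => Set.mem_iUnion.2 ⟨σ, PiNat.self_mem_cylinder σ _⟩)
  -- Every point of `K_w` has a code beginning with `w`.
  have hw : ∀ w : List (Fin k), ∀ σ : ℕ → Fin k, ∃ τ : ℕ → Fin k, F.wmap w (F.π σ) = F.π τ ∧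
      ∀ (i : ℕ) (hi : i < w.length), τ i = w[i] := by
    intro w σ
    induction w with
    | nil => exact ⟨σ, rfl, fun i hi => absurd hi (by simp)⟩
    | cons j w ih =>
      obtain ⟨τ, h1, h2⟩ := ih
      refine ⟨consWord j τ, by rw [wmap_cons, h1, F.ψ_π], ?_⟩
      rintro (_ | i) hi
      · rfl
      · exact h2 i (by simpa using hi)
  refine ⟨s.sup m, fun w hlen x hx y hy => ?_⟩
  obtain ⟨x, rfl⟩ := hx
  obtain ⟨y, rfl⟩ := hy
  obtain ⟨σ, rfl⟩ := F.π_surjective x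
  obtain ⟨τ, rfl⟩ := F.π_surjective y
  obtain ⟨σ', h1, h1'⟩ := hw w σ
  obtain ⟨τ', h2, h2'⟩ := hw w τ
  rw [h1, h2]
  obtain ⟨ρ, hρs, hρ⟩ := Set.mem_iUnion₂.1 (hs (Set.mem_univ σ'))
  have hle : m ρ ≤ w.length := hlen ▸ Finset.le_sup hρs
  have h3 := hm ρ σ' fun i hi => hρ i hi
  have h4 := hm ρ τ' fun i hi => by
    rw [h2' i (by omega), ← h1' i (by omega)]; exact hρ i hi
  calc _ ≤ _ := dist_triangle_right _ _ (F.π ρ)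
    _ < ε := by linarith

/-! ### Sums along paths -/

theorem edgeRatio_nonneg (F : SelfSimilarFractal k N K) (hα : IsPolyratio α) (x y : K) :
    0 ≤ F.edgeRatio α x y := (hα.wordRatio_pos _).le

theorem IsRep.map {x y : K} {v : List (Fin k)} {ι : IndexPair N} (h : F.IsRep x y v ι)
    (w : List (Fin k)) : F.IsRep (F.wmap w x) (F.wmap w y) (w ++ v) ι :=
  ⟨by rw [h.1, wmap_append], by rw [h.2, wmap_append]⟩

theorem Adj.word_map {x y : K} (h : F.Adj x y) (w : List (Fin k)) :
    F.word (F.wmap w x) (F.wmap w y) = w ++ F.word x y := by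
  obtain ⟨v, ι, hv⟩ := h
  rw [(hv.map w).word_eq, hv.word_eq]

theorem IsPath.edgeSum_map {p : PointSeq K} (h : F.IsPath p) (w : List (Fin k)) :
    (p.map (F.wmap w)).edgeSum (F.edgeRatio α) =
      wordRatio α w * p.edgeSum (F.edgeRatio α) := by
  unfold PointSeq.edgeSum
  rw [Finset.mul_sum]
  refine Finset.sum_congr rfl fun j hj => ?_
  change wordRatio α (F.word (F.wmap w _) (F.wmap w _)) = _
  rw [(h.2 j (Finset.mem_range.1 hj)).word_map, wordRatio_append]
  rfl

theorem IsPathFor.pos {ι : IndexPair N} {p : PointSeq K} (h : F.IsPathFor ι p) : 0 < p.n := by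
  rcases Nat.eq_zero_or_pos p.n with h0 | h0
  · have h1 := h.2.1
    have h2 := h.2.2
    rw [h0, h1] at h2
    exact absurd (F.bd_injective h2) ι.2
  · exact h0

theorem one_le_edgeSum_of_not_strong (hα : IsPolyratio α) {p : PointSeq K} (h : ¬ F.Strong p) :
    1 ≤ p.edgeSum (F.edgeRatio α) := by
  unfold Strong at h
  push Not at h
  obtain ⟨j, hj, hw⟩ := h
  refine le_trans (le_of_eq ?_) (p.le_edgeSum (F.edgeRatio_nonneg hα) hj)
  rw [edgeRatio, hw, wordRatio_nil]

/-- Induction on the maximal word length along `p`. An edge with empty word already contributes `1`.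
Otherwise (iii) provides disjoint pieces of `p` dominating copies `ψ_w(q)`, one for each edge of
`Π_{s'}`. Each `q` has shorter words, hence sum at least `1`, and the total is at least the sum of
`Π_{s'}`. -/
theorem CondIII.one_le_edgeSum {r : ℕ} {Pi : Fin r → PointSeq K} {ι : Fin r → IndexPair N}
    (h : F.CondIII Pi ι) (hstrong : ∀ s, F.Strong (Pi s)) (hα : IsPolyratio α)
    (hsum : ∀ s, 1 ≤ (Pi s).edgeSum (F.edgeRatio α)) (s : Fin r) (p : PointSeq K)
    (hp : F.IsPathFor (ι s) p) : 1 ≤ p.edgeSum (F.edgeRatio α) := by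
  have key : ∀ (M : ℕ) (s : Fin r) (p : PointSeq K), F.IsPathFor (ι s) p →
      (∀ j < p.n, (F.word (p.pt j) (p.pt (j + 1))).length ≤ M) →
      1 ≤ p.edgeSum (F.edgeRatio α) := by
    intro M
    induction M with
    | zero =>
      intro s p hp hM
      refine one_le_edgeSum_of_not_strong hα fun hs => ?_
      exact hs 0 hp.pos (List.length_eq_zero_iff.1 (Nat.le_zero.1 (hM 0 hp.pos)))
    | succ M ih =>
      intro s p hp hM
      by_cases hs : F.Strong p
      swap
      · exact one_le_edgeSum_of_not_strong hα hs
      obtain ⟨s', a, b, hab, hβ⟩ := h s p hp hs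
      refine le_trans ?_ (PointSeq.sum_edgeSum_sub_le hab (F.edgeRatio_nonneg hα))
      have h1 := hsum s'
      unfold PointSeq.edgeSum at h1
      rw [← Fin.sum_univ_eq_sum_range
        (fun j => F.edgeRatio α ((Pi s').pt j) ((Pi s').pt (j + 1)))] at h1
      refine h1.trans (Finset.sum_le_sum fun β _ => ?_)
      obtain ⟨p', q, t, href, hq, hsame⟩ := hβ β
      refine le_trans ?_ (PointSeq.edgeSum_le_of_isRefinement href (F.edgeRatio_nonneg hα))
      rw [hsame.edgeSum_eq, hq.1.edgeSum_map]
      refine le_mul_of_one_le_right (hα.wordRatio_pos _).le (ih t q hq fun j hj => ?_)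
      have hj' : j < p'.n := by rw [hsame.1]; exact hj
      obtain ⟨i, hi, e1, e2⟩ := href.exists_edge hj'
      rw [hsame.2 j hj'.le] at e1
      rw [hsame.2 (j + 1) hj'] at e2
      have h2 := (hq.1.2 j hj).word_map (F.word ((Pi s').pt β) ((Pi s').pt (β + 1)))
      have hb := (hab.1 β).2
      have h3 := hM (a β + i) (by change i < b β - a β at hi; omega)
      change F.wmap _ (q.pt j) = p.pt (a β + i) at e1
      change F.wmap _ (q.pt (j + 1)) = p.pt (a β + i + 1) at e2
      rw [← e1, ← e2, h2, List.length_append] at h3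
      -- Since `Π_{s'}` is strong, the prefix is nonempty and the words of `q` are strictly shorter.
      have h4 := List.length_pos_iff.2 (hstrong s' β β.2)
      omega
  refine key ((Finset.range p.n).sup fun j => (F.word (p.pt j) (p.pt (j + 1))).length) s p hp ?_
  intro j hj
  exact Finset.le_sup (f := fun j => (F.word (p.pt j) (p.pt (j + 1))).length)
    (Finset.mem_range.2 hj)

theorem CondII.exists_le_edgeSum {r : ℕ} {ι : Fin r → IndexPair N} (h : F.CondII ι)
    (hα : IsPolyratio α)
    (hsum : ∀ s p, F.IsPathFor (ι s) p → 1 ≤ p.edgeSum (F.edgeRatio α)) :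
    ∃ c : ℝ, 0 < c ∧ c ≤ 1 ∧ ∀ (p : PointSeq K) (i j : Fin N), i ≠ j → F.IsPath p →
      p.Connects (F.bd i) (F.bd j) → c ≤ p.edgeSum (F.edgeRatio α) := by
  obtain ⟨m, hm⟩ := h
  obtain ⟨a, ha, ha1, hle⟩ := hα.exists_lower_bound
  -- Either some edge has a word shorter than `m`, or (ii) yields a copy of an `ι_s`-path at level
  -- `m`; both cost at least `a ^ m`.
  refine ⟨a ^ m, by positivity, pow_le_one₀ ha.le ha1, fun p i j hij hp hc => ?_⟩
  by_cases hw : ∀ h < p.n, m ≤ (F.word (p.pt h) (p.pt (h + 1))).length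
  · obtain ⟨x, y, s, w, q, -, hy, hl, hq, hsame⟩ :=
      hm p _ _ hp ⟨i, rfl⟩ ⟨j, rfl⟩ (F.bd_injective.ne hij) hc hw
    refine le_trans ?_ (p.edgeSum_sub_le (a := x) hy (F.edgeRatio_nonneg hα))
    rw [hsame.edgeSum_eq, hq.1.edgeSum_map]
    exact (pow_le_wordRatio ha ha1 hle hl.le).trans
      (le_mul_of_one_le_right (hα.wordRatio_pos _).le (hsum s q hq))
  · push Not at hw
    obtain ⟨l, hl, hlt⟩ := hw
    exact (pow_le_wordRatio ha ha1 hle hlt.le).trans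
      (p.le_edgeSum (F.edgeRatio_nonneg hα) hl)

/-- If `d(ψ_w(P_ι)) ≤ C α_w` for every word `w`, then an `ι`-path with edges of type `ι` has
sum at least `1`. -/
theorem one_le_edgeSum_of_dist_le (hα : IsPolyratio α) {d : K → K → ℝ} (hd : IsDistance d)
    {p : PointSeq K} {ι : IndexPair N} (hp : F.IsPathFor ι p)
    (hrep : ∀ h < p.n, F.IsRep (p.pt h) (p.pt (h + 1)) (F.word (p.pt h) (p.pt (h + 1))) ι)
    {C : ℝ} (hC : ∀ w, d (F.wmap w (F.bd ι.1.1)) (F.wmap w (F.bd ι.1.2)) ≤ C * wordRatio α w) :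
    1 ≤ p.edgeSum (F.edgeRatio α) := by
  by_contra! hlt
  set S := p.edgeSum (F.edgeRatio α) with hS
  have hS0 : 0 ≤ S := Finset.sum_nonneg fun _ _ => F.edgeRatio_nonneg hα _ _
  -- Each subdivision along `p` gains a factor `S`; the new edges have type `ι` again, so the bound
  -- can be iterated.
  have key : ∀ (n : ℕ) (w : List (Fin k)),
      d (F.wmap w (F.bd ι.1.1)) (F.wmap w (F.bd ι.1.2)) ≤ C * S ^ n * wordRatio α w := by
    intro n
    induction n with
    | zero => intro w; simpa using hC w
    | succ n ih =>
      intro w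
      have h1 := hd.le_edgeSum (p.map (F.wmap w))
      change d (F.wmap w (p.pt 0)) (F.wmap w (p.pt p.n)) ≤ _ at h1
      rw [hp.2.1, hp.2.2] at h1
      refine h1.trans ?_
      have h2 : C * S ^ (n + 1) * wordRatio α w =
          ∑ h ∈ Finset.range p.n, C * S ^ n * (wordRatio α w *
            F.edgeRatio α (p.pt h) (p.pt (h + 1))) := by
        rw [← Finset.mul_sum, ← Finset.mul_sum]
        change _ = C * S ^ n * (wordRatio α w * S)
        ring
      rw [h2]
      refine Finset.sum_le_sum fun h hh => ?_
      have hr := (hrep h (Finset.mem_range.1 hh)).map w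
      have h3 := ih (w ++ F.word (p.pt h) (p.pt (h + 1)))
      rw [← hr.1, ← hr.2, wordRatio_append] at h3
      exact h3
  have hlim : Filter.Tendsto (fun n : ℕ => C * S ^ n) Filter.atTop (nhds 0) := by
    simpa using (tendsto_pow_atTop_nhds_zero_of_lt_one hS0 hlt).const_mul C
  have hle : d (F.bd ι.1.1) (F.bd ι.1.2) ≤ 0 := by
    refine ge_of_tendsto' hlim fun n => ?_
    have h := key n []
    rwa [wordRatio_nil, mul_one] at h
  have h0 := le_antisymm hle (hd.nonneg _ _)
  exact ι.2 (F.bd_injective ((hd.eq_zero_iff _ _).1 h0))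

theorem wmap_bd_mem_Vinf (F : SelfSimilarFractal k N K) (w : List (Fin k)) (j : Fin N) :
    F.wmap w (F.bd j) ∈ F.Vinf :=
  Set.mem_iUnion.2 ⟨w.length, w, rfl, _, ⟨j, rfl⟩, rfl⟩

theorem exists_path_cons {p : PointSeq K} {x : K} (hp : F.IsPath p) (h : F.Adj x (p.pt 0)) :
    ∃ p' : PointSeq K, F.IsPath p' ∧ p'.Connects x (p.pt p.n) ∧
      p'.edgeSum (F.edgeRatio α) = F.edgeRatio α x (p.pt 0) + p.edgeSum (F.edgeRatio α) := by
  refine ⟨⟨p.n + 1, fun j => Nat.casesOn j x p.pt⟩, ⟨?_, ?_⟩, ⟨rfl, rfl⟩, ?_⟩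
  · rintro (_ | j) hj
    · obtain ⟨w, ι, h1, -⟩ := h
      change x ∈ F.Vinf
      rw [h1]
      exact F.wmap_bd_mem_Vinf w _
    · exact hp.1 j (Nat.le_of_succ_le_succ hj)
  · rintro (_ | j) hj
    · exact h
    · exact hp.2 j (Nat.lt_of_succ_lt_succ hj)
  · unfold PointSeq.edgeSum
    rw [Finset.sum_range_succ', add_comm]
    rfl

/-! ### Chains of cells -/

/-- `t` is the sum of the ratios `α_w` of the cells of a chain of cells from `x` to `y`. -/
inductive ChainCost (F : SelfSimilarFractal k N K) (α : Fin k → ℝ) : K → K → ℝ → Prop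
  | nil (x : K) : ChainCost F α x x 0
  | cons {x z y : K} {w : List (Fin k)} {t : ℝ} : x ∈ F.copy w → z ∈ F.copy w →
      ChainCost F α z y t → ChainCost F α x y (wordRatio α w + t)

/-- `t` is the sum of the ratios of a chain of cells from `x` to `y` with first cell `K_w`, in which
consecutive cells are not contained in each other. -/
inductive ReducedCost (F : SelfSimilarFractal k N K) (α : Fin k → ℝ) :
    K → List (Fin k) → K → ℝ → Prop
  | single {x y : K} {w : List (Fin k)} : x ∈ F.copy w → y ∈ F.copy w →
      ReducedCost F α x w y (wordRatio α w)
  | cons {x z y : K} {w w' : List (Fin k)} {t : ℝ} : x ∈ F.copy w → z ∈ F.copy w →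
      ¬ w <+: w' → ¬ w' <+: w → ReducedCost F α z w' y t →
      ReducedCost F α x w y (wordRatio α w + t)

theorem ReducedCost.mem_copy {x y : K} {w : List (Fin k)} {t : ℝ}
    (h : F.ReducedCost α x w y t) : x ∈ F.copy w := by
  cases h with
  | single h _ => exact h
  | cons h _ _ _ _ => exact h

/-- When the new cell and the first cell are nested, the smaller is dropped. If the new one is
larger, it may swallow further cells, whence the induction. -/
theorem ReducedCost.exists_prepend (hα : IsPolyratio α) {z y : K} {w' : List (Fin k)} {t : ℝ}
    (h : F.ReducedCost α z w' y t) {x : K} {w : List (Fin k)} (hx : x ∈ F.copy w)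
    (hz : z ∈ F.copy w) : ∃ v s, s ≤ wordRatio α w + t ∧ F.ReducedCost α x v y s := by
  induction h with
  | @single z y w' hz' hy =>
    have h0 := hα.wordRatio_pos w
    have h0' := hα.wordRatio_pos w'
    by_cases h1 : w <+: w'
    · exact ⟨w, _, by linarith, .single hx (F.copy_subset_of_prefix h1 hy)⟩
    by_cases h2 : w' <+: w
    · exact ⟨w', _, by linarith, .single (F.copy_subset_of_prefix h2 hx) hy⟩
    exact ⟨w, _, le_rfl, .cons hx hz h1 h2 (.single hz' hy)⟩
  | @cons z u y w' w'' t hz' hu h3 h4 hr ih =>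
    have h0 := hα.wordRatio_pos w
    have h0' := hα.wordRatio_pos w'
    by_cases h1 : w <+: w'
    · obtain ⟨v, s, hs, hv⟩ := ih (F.copy_subset_of_prefix h1 hu)
      exact ⟨v, s, by linarith, hv⟩
    by_cases h2 : w' <+: w
    · exact ⟨w', _, by linarith, .cons (F.copy_subset_of_prefix h2 hx) hu h3 h4 hr⟩
    exact ⟨w, _, le_rfl, .cons hx hz h1 h2 (.cons hz' hu h3 h4 hr)⟩

theorem ChainCost.nonneg (hα : IsPolyratio α) {x y : K} {t : ℝ} (h : F.ChainCost α x y t) :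
    0 ≤ t := by
  induction h with
  | nil => exact le_rfl
  | @cons _ _ _ w t _ _ _ ih => linarith [hα.wordRatio_pos w]

theorem ChainCost.exists_reducedCost (hα : IsPolyratio α) {x y : K} {t : ℝ}
    (h : F.ChainCost α x y t) : x = y ∨ ∃ v s, s ≤ t ∧ F.ReducedCost α x v y s := by
  induction h with
  | nil x => exact .inl rfl
  | @cons x z y w t hx hz hch ih =>
    right
    have := hch.nonneg hα
    rcases ih with rfl | ⟨v, s, hs, hv⟩
    · exact ⟨w, _, by linarith, ReducedCost.single hx hz⟩
    · obtain ⟨v', s', hs', hv'⟩ := hv.exists_prepend hα hx hz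
      exact ⟨v', s', by linarith, hv'⟩

/-- Consecutive cells are not nested, so the chain passes between them at common vertices; each cell
then contributes one edge, or none if it is entered and left at the same vertex. -/
theorem ReducedCost.exists_path (hα : IsPolyratio α) {x y : K} {w : List (Fin k)} {t : ℝ}
    (h : F.ReducedCost α x w y t) (hx : x ∈ F.wmap w '' F.V0) (hy : y ∈ F.V0) :
    ∃ p : PointSeq K, F.IsPath p ∧ p.Connects x y ∧ p.edgeSum (F.edgeRatio α) ≤ t := by
  have step : ∀ {x z y : K} {w : List (Fin k)} {t : ℝ}, x ∈ F.wmap w '' F.V0 →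
      z ∈ F.wmap w '' F.V0 →
      (∃ p : PointSeq K, F.IsPath p ∧ p.Connects z y ∧ p.edgeSum (F.edgeRatio α) ≤ t) →
      ∃ p : PointSeq K, F.IsPath p ∧ p.Connects x y ∧
        p.edgeSum (F.edgeRatio α) ≤ wordRatio α w + t := by
    rintro x z y w t ⟨_, ⟨i, rfl⟩, rfl⟩ ⟨_, ⟨j, rfl⟩, rfl⟩ ⟨p, hp, hc, hs⟩
    by_cases hij : i = j
    · subst hij
      exact ⟨p, hp, hc, by linarith [hα.wordRatio_pos w]⟩
    · have hrep : F.IsRep (F.wmap w (F.bd i)) (F.wmap w (F.bd j)) w ⟨(i, j), hij⟩ := ⟨rfl, rfl⟩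
      obtain ⟨p', h1, h2, h3⟩ := exists_path_cons (α := α) hp
        (show F.Adj (F.wmap w (F.bd i)) (p.pt 0) from hc.1 ▸ ⟨w, _, hrep⟩)
      refine ⟨p', h1, hc.2 ▸ h2, ?_⟩
      rw [h3, hc.1, edgeRatio, hrep.word_eq]
      linarith
  induction h with
  | @single x y w hx' hy' =>
    have := step (t := 0) hx (F.mem_vertices_of_mem_V0 hy hy')
      ⟨⟨0, fun _ => y⟩, ⟨fun _ _ => ?_, fun _ h => absurd h (Nat.not_lt_zero _)⟩, ⟨rfl, rfl⟩,
        by simp [PointSeq.edgeSum]⟩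
    · simpa using this
    · obtain ⟨j, rfl⟩ := hy
      exact F.wmap_bd_mem_Vinf [] j
  | @cons x z y w w' t hx' hz' h1 h2 hr ih =>
    obtain ⟨h3, h4⟩ := F.mem_vertices_of_not_prefix h1 h2 hz' hr.mem_copy
    exact step hx h3 (ih h4 hy)

theorem ChainCost.le_of_forall_path (hα : IsPolyratio α) {c : ℝ}
    (hc : ∀ (p : PointSeq K) (i j : Fin N), i ≠ j → F.IsPath p →
      p.Connects (F.bd i) (F.bd j) → c ≤ p.edgeSum (F.edgeRatio α))
    {i j : Fin N} (hij : i ≠ j) {t : ℝ} (h : F.ChainCost α (F.bd i) (F.bd j) t) : c ≤ t := by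
  rcases h.exists_reducedCost hα with h | ⟨v, s, hs, hv⟩
  · exact absurd (F.bd_injective h) hij
  · obtain ⟨p, hp, hcon, hle⟩ := hv.exists_path hα
      (F.mem_vertices_of_mem_V0 ⟨i, rfl⟩ hv.mem_copy) ⟨j, rfl⟩
    exact (hc p i j hij hp hcon).trans (hle.trans hs)

/-! ### The chain distance. -/

theorem ChainCost.single {x y : K} {w : List (Fin k)} (hx : x ∈ F.copy w) (hy : y ∈ F.copy w) :
    F.ChainCost α x y (wordRatio α w) := by
  simpa using ChainCost.cons (α := α) hx hy (.nil y)

theorem ChainCost.trans {x y z : K} {s t : ℝ} (h : F.ChainCost α x y s)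
    (h' : F.ChainCost α y z t) : F.ChainCost α x z (s + t) := by
  induction h with
  | nil => simpa using h'
  | cons hx hz _ ih => rw [add_assoc]; exact .cons hx hz (ih h')

theorem ChainCost.symm {x y : K} {t : ℝ} (h : F.ChainCost α x y t) : F.ChainCost α y x t := by
  induction h with
  | nil => exact .nil _
  | cons hx hz _ ih => rw [add_comm]; exact ih.trans (.single hz hx)

theorem ChainCost.map {x y : K} {t : ℝ} (h : F.ChainCost α x y t) (i : Fin k) :
    F.ChainCost α (F.ψ i x) (F.ψ i y) (α i * t) := by
  have hmem : ∀ {x : K} {w : List (Fin k)}, x ∈ F.copy w → F.ψ i x ∈ F.copy (i :: w) := by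
    rintro _ w ⟨x, rfl⟩
    exact ⟨x, rfl⟩
  induction h with
  | nil => rw [mul_zero]; exact .nil _
  | cons hx hz _ ih =>
    rw [mul_add, ← wordRatio_cons]
    exact .cons (hmem hx) (hmem hz) ih

/-- The infimum of the sums of the ratios `α_w` along the chains of cells from `x` to `y`. -/
noncomputable def chainDist (F : SelfSimilarFractal k N K) (α : Fin k → ℝ) (x y : K) : ℝ :=
  sInf {t | F.ChainCost α x y t}

theorem ChainCost.chainDist_le (hα : IsPolyratio α) {x y : K} {t : ℝ}
    (h : F.ChainCost α x y t) : F.chainDist α x y ≤ t :=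
  csInf_le ⟨0, fun _ hs => ChainCost.nonneg hα hs⟩ h

theorem chainDist_le_wordRatio (hα : IsPolyratio α) {x y : K} {w : List (Fin k)}
    (hx : x ∈ F.copy w) (hy : y ∈ F.copy w) : F.chainDist α x y ≤ wordRatio α w :=
  (ChainCost.single hx hy).chainDist_le hα

theorem le_chainDist {x y : K} {c : ℝ} (h : ∀ t, F.ChainCost α x y t → c ≤ t) :
    c ≤ F.chainDist α x y :=
  -- The empty word, whose cell is all of `K`, gives a chain between any two points.
  le_csInf ⟨_, ChainCost.single (w := []) ⟨x, rfl⟩ ⟨y, rfl⟩⟩ h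

theorem chainDist_nonneg (hα : IsPolyratio α) (x y : K) : 0 ≤ F.chainDist α x y :=
  le_chainDist fun _ h => h.nonneg hα

theorem chainDist_le_one (hα : IsPolyratio α) (x y : K) : F.chainDist α x y ≤ 1 :=
  chainDist_le_wordRatio (w := []) hα ⟨x, rfl⟩ ⟨y, rfl⟩

theorem chainDist_self (hα : IsPolyratio α) (x : K) : F.chainDist α x x = 0 :=
  le_antisymm ((ChainCost.nil x).chainDist_le hα) (chainDist_nonneg hα x x)

theorem chainDist_symm (x y : K) : F.chainDist α x y = F.chainDist α y x := by
  unfold chainDist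
  congr 1
  ext t
  exact ⟨ChainCost.symm, ChainCost.symm⟩

theorem chainDist_triangle (hα : IsPolyratio α) (x y z : K) :
    F.chainDist α x z ≤ F.chainDist α x y + F.chainDist α y z := by
  rw [← sub_le_iff_le_add]
  refine le_chainDist fun s hs => ?_
  rw [sub_le_comm]
  refine le_chainDist fun t ht => ?_
  rw [sub_le_iff_le_add']
  exact (hs.trans ht).chainDist_le hα

theorem chainDist_ψ_le (hα : IsPolyratio α) (i : Fin k) (x y : K) :
    F.chainDist α (F.ψ i x) (F.ψ i y) ≤ α i * F.chainDist α x y := by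
  rw [← div_le_iff₀' (hα i).1]
  refine le_chainDist fun t ht => ?_
  rw [div_le_iff₀' (hα i).1]
  exact (ht.map i).chainDist_le hα

theorem chainDist_wmap_le (hα : IsPolyratio α) (w : List (Fin k)) (x y : K) :
    F.chainDist α (F.wmap w x) (F.wmap w y) ≤ wordRatio α w * F.chainDist α x y := by
  induction w with
  | nil => rw [wordRatio_nil, one_mul]; exact le_rfl
  | cons i w ih =>
    rw [wordRatio_cons, mul_assoc]
    exact (chainDist_ψ_le hα i _ _).trans (mul_le_mul_of_nonneg_left ih (hα i).1.le)

/-- A chain starting in `K_u` with small sum ends in an `m`-cell containing `ψ_u(P_a)`, provided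
that its first point is close to `ψ_u(P_a)` within `K_u`. -/
theorem ChainCost.exists_cell_of_vertex (hα : IsPolyratio α) {c ε : ℝ} {m : ℕ}
    (hc : ∀ i j : Fin N, i ≠ j → c ≤ F.chainDist α (F.bd i) (F.bd j))
    (hε : ∀ w : List (Fin k), w.length ≤ m → ε ≤ wordRatio α w)
    (hεc : ∀ w : List (Fin k), w.length = m → ε ≤ wordRatio α w * c)
    {z y : K} {t : ℝ} (h : F.ChainCost α z y t) {u : List (Fin k)} (hu : u.length = m)
    {a : Fin N} {z₀ : K} (hz : F.wmap u z₀ = z)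
    (ht : wordRatio α u * F.chainDist α (F.bd a) z₀ + t < ε) :
    ∃ u' : List (Fin k), u'.length = m ∧ y ∈ F.copy u' ∧ F.wmap u (F.bd a) ∈ F.copy u' := by
  induction h generalizing u a z₀ with
  | nil x => exact ⟨u, hu, ⟨z₀, hz⟩, ⟨_, rfl⟩⟩
  | @cons x z y w t hx hzw hch ih =>
    have ht0 := hch.nonneg hα
    have hu0 := hα.wordRatio_pos u
    have hd0 := mul_nonneg hu0.le (chainDist_nonneg (F := F) hα (F.bd a) z₀)
    -- A cell of level at most `m` would by itself cost at least `ε`.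
    have hwm : m < w.length := by
      by_contra! hle
      have := hε w hle
      linarith
    by_cases hp : u <+: w
    · obtain ⟨v, rfl⟩ := hp
      obtain ⟨x₁, rfl⟩ := hx
      obtain ⟨z₁, rfl⟩ := hzw
      rw [wmap_append] at hz
      have hz := F.wmap_injective u hz
      subst hz
      -- Inside `K_u` the triangle inequality keeps the quantity bounded in `ht` from increasing.
      refine ih hu (z₀ := F.wmap v z₁) (F.wmap_append u v z₁).symm ?_
      have h1 := chainDist_triangle (F := F) hα (F.bd a) (F.wmap v x₁) (F.wmap v z₁)
      have h2 := chainDist_le_wordRatio (F := F) (w := v) hα ⟨x₁, rfl⟩ ⟨z₁, rfl⟩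
      rw [wordRatio_append] at ht
      have h3 := mul_le_mul_of_nonneg_left (h1.trans (add_le_add_right h2 _)) hu0.le
      rw [mul_add] at h3
      linarith
    · have hlen : (w.take m).length = m := by rw [List.length_take]; omega
      have hne : u ≠ w.take m := fun he => hp (he ▸ List.take_prefix _ _)
      obtain ⟨⟨_, ⟨b, rfl⟩, hb⟩, ⟨_, ⟨b', rfl⟩, hb'⟩⟩ := F.mem_vertices_of_length_eq hne
        (hu.trans hlen.symm) ⟨z₀, hz⟩ (F.copy_subset_of_prefix (List.take_prefix m w) hx)
      have hz₀ := F.wmap_injective u (hz.trans hb.symm)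
      subst hz₀
      -- The chain leaves `K_u` at a vertex; a vertex other than `ψ_u(P_a)` would cost at least `α_u
      -- c ≥ ε`.
      have hab : a = b := by
        by_contra hab
        have h1 := mul_le_mul_of_nonneg_left (hc a b hab) hu0.le
        have h2 := hεc u hu
        have h3 := hα.wordRatio_pos w
        linarith
      subst hab
      rw [hz, ← hb']
      obtain ⟨x₁, rfl⟩ := hx
      obtain ⟨z₁, rfl⟩ := hzw
      obtain ⟨v, hv⟩ := List.take_prefix m w
      set u' := w.take m with hu'
      clear_value u'
      subst hv
      -- The same point is a vertex of the new cell `K_{u'}`, and the distance from it is now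
      -- measured there.
      refine ih hlen (z₀ := F.wmap v z₁) (F.wmap_append u' v z₁).symm ?_
      rw [wmap_append] at hb'
      rw [F.wmap_injective u' hb']
      have h2 := chainDist_le_wordRatio (F := F) (w := v) hα ⟨x₁, rfl⟩ ⟨z₁, rfl⟩
      have h3 := mul_le_mul_of_nonneg_left h2 (hα.wordRatio_pos u').le
      rw [wordRatio_append] at ht
      linarith

theorem ChainCost.exists_cell (hα : IsPolyratio α) {c ε : ℝ} {m : ℕ}
    (hc : ∀ i j : Fin N, i ≠ j → c ≤ F.chainDist α (F.bd i) (F.bd j))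
    (hε : ∀ w : List (Fin k), w.length ≤ m → ε ≤ wordRatio α w)
    (hεc : ∀ w : List (Fin k), w.length = m → ε ≤ wordRatio α w * c)
    {z y : K} {t : ℝ} (h : F.ChainCost α z y t) {u : List (Fin k)} (hu : u.length = m)
    (hz : z ∈ F.copy u) (ht : t < ε) :
    ∃ u' : List (Fin k), u'.length = m ∧ y ∈ F.copy u' ∧ (F.copy u ∩ F.copy u').Nonempty := by
  induction h with
  | nil x => exact ⟨u, hu, hz, x, hz, hz⟩
  | @cons x z y w t hx hzw hch ih =>
    have hw0 := hα.wordRatio_pos w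
    by_cases hp : u <+: w
    · exact ih (F.copy_subset_of_prefix hp hzw) (by linarith)
    · have hwm : m < w.length := by
        by_contra! hle
        have := hε w hle
        have := hch.nonneg hα
        linarith
      have hlen : (w.take m).length = m := by rw [List.length_take]; omega
      have hne : u ≠ w.take m := fun he => hp (he ▸ List.take_prefix _ _)
      obtain ⟨-, ⟨_, ⟨b, rfl⟩, hb⟩⟩ := F.mem_vertices_of_length_eq hne
        (hu.trans hlen.symm) hz (F.copy_subset_of_prefix (List.take_prefix m w) hx)
      -- At its first exit from `K_u` the chain is at a vertex `x` of the next `m`-cell, so the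
      -- remaining chain starts at distance `0` from that vertex.
      obtain ⟨u', h1, h2, h3⟩ := (ChainCost.cons hx hzw hch).exists_cell_of_vertex hα hc hε hεc
        hlen (a := b) hb (by rw [chainDist_self hα, mul_zero, zero_add]; exact ht)
      exact ⟨u', h1, h2, x, hz, hb ▸ h3⟩

theorem chainDist_pos (hα : IsPolyratio α) {c : ℝ} (hc0 : 0 < c) (hc1 : c ≤ 1)
    (hc : ∀ i j : Fin N, i ≠ j → c ≤ F.chainDist α (F.bd i) (F.bd j)) {x y : K} (hxy : x ≠ y) :
    0 < F.chainDist α x y := by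
  obtain ⟨m, hm⟩ := F.exists_forall_dist_lt (half_pos (dist_pos.2 hxy))
  obtain ⟨a, ha, ha1, hle⟩ := hα.exists_lower_bound
  have ham : 0 < a ^ m := by positivity
  have hε : ∀ w : List (Fin k), w.length ≤ m → a ^ m * c ≤ wordRatio α w := fun w hw =>
    (mul_le_of_le_one_right ham.le hc1).trans (pow_le_wordRatio ha ha1 hle hw)
  have hεc : ∀ w : List (Fin k), w.length = m → a ^ m * c ≤ wordRatio α w * c := fun w hw =>
    mul_le_mul_of_nonneg_right (pow_le_wordRatio ha ha1 hle hw.le) hc0.le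
  have hcell : ∃ u : List (Fin k), u.length = m ∧ x ∈ F.copy u := by
    obtain ⟨σ, rfl⟩ := F.π_surjective x
    clear hxy hm hε hεc ham
    induction m generalizing σ with
    | zero => exact ⟨[], rfl, _, rfl⟩
    | succ m ih =>
      obtain ⟨u, hu, z, hz⟩ := ih fun n => σ (n + 1)
      refine ⟨σ 0 :: u, by simp [hu], z, ?_⟩
      rw [wmap_cons, hz, F.ψ_π]
      congr 1
      funext n
      cases n <;> rfl
  obtain ⟨u, hu, hxu⟩ := hcell
  -- A chain cheaper than `a ^ m * c` would put `x` and `y` in intersecting `m`-cells, each of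
  -- diameter too small for this.
  refine (mul_pos ham hc0).trans_le (le_chainDist fun t ht => ?_)
  by_contra! hlt
  obtain ⟨u', hu', hy, z, hz, hz'⟩ := ht.exists_cell hα hc hε hεc hu hxu hlt
  have h1 := hm u hu x hxu z hz
  have h2 := hm u' hu' z hz' y hy
  have h3 := dist_triangle x z y
  linarith

theorem isDistance_chainDist (hα : IsPolyratio α) {c : ℝ} (hc0 : 0 < c) (hc1 : c ≤ 1)
    (hc : ∀ i j : Fin N, i ≠ j → c ≤ F.chainDist α (F.bd i) (F.bd j)) :
    IsDistance (F.chainDist α) where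
  eq_zero_iff x y := by
    refine ⟨fun h => ?_, fun h => h ▸ chainDist_self hα x⟩
    by_contra hxy
    exact (chainDist_pos hα hc0 hc1 hc hxy).ne' h
  symm := chainDist_symm
  triangle := chainDist_triangle hα

/-- A chain from a point of `K_w` to a vertex of `K_w` has either a cell containing `K_w` or an
initial part inside `K_w` that leads to a vertex. -/
theorem ChainCost.wordRatio_mul_le (hα : IsPolyratio α) {w : List (Fin k)} {z y : K} {t : ℝ}
    (h : F.ChainCost α z y t) {z₀ : K} (hz : F.wmap w z₀ = z) (hy : y ∈ F.wmap w '' F.V0) {ε : ℝ}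
    (hε1 : ε ≤ 1) (hε : ∀ j, ε ≤ F.chainDist α z₀ (F.bd j)) : wordRatio α w * ε ≤ t := by
  have hw0 := hα.wordRatio_pos w
  have hvert : F.wmap w z₀ ∈ F.wmap w '' F.V0 → ε ≤ 0 := by
    rintro ⟨_, ⟨j, rfl⟩, hj⟩
    rw [← F.wmap_injective w hj] at hε
    exact (hε j).trans_eq (chainDist_self hα _)
  induction h generalizing z₀ ε with
  | nil x => exact mul_nonpos_of_nonneg_of_nonpos hw0.le (hvert (hz ▸ hy))
  | @cons x z y v t hx hzv hch ih =>
    have ht0 := hch.nonneg hα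
    have hv0 := hα.wordRatio_pos v
    by_cases h1 : v <+: w
    · have h2 := hα.wordRatio_le_of_prefix h1
      have h3 := mul_le_of_le_one_right hw0.le hε1
      linarith
    by_cases h2 : w <+: v
    · obtain ⟨u, rfl⟩ := h2
      obtain ⟨x₁, rfl⟩ := hx
      obtain ⟨z₁, rfl⟩ := hzv
      rw [wmap_append] at hz
      have hz := F.wmap_injective w hz
      subst hz
      have hu0 := hα.wordRatio_pos u
      have h3 := chainDist_le_wordRatio (F := F) (w := u) hα ⟨x₁, rfl⟩ ⟨z₁, rfl⟩
      -- The allowance `ε` drops by the cost spent inside `K_w`; it may become negative, so no sign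
      -- is imposed on it.
      have hε' : ∀ j, ε - wordRatio α u ≤ F.chainDist α (F.wmap u z₁) (F.bd j) := fun j => by
        have h4 := chainDist_triangle (F := F) hα (F.wmap u x₁) (F.wmap u z₁) (F.bd j)
        have h5 := hε j
        linarith
      have h6 := ih (z₀ := F.wmap u z₁) (F.wmap_append w u z₁).symm hy
        (ε := ε - wordRatio α u) (by linarith) hε' (by
          rintro ⟨_, ⟨j, rfl⟩, hj⟩
          have h7 := hε' j
          rwa [F.wmap_injective w hj, chainDist_self hα] at h7)
      rw [wordRatio_append]
      rw [mul_sub] at h6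
      linarith
    · have h3 := (F.mem_vertices_of_not_prefix h2 h1 ⟨z₀, hz⟩ hx).1
      have h4 := mul_nonpos_of_nonneg_of_nonpos hw0.le (hvert (hz ▸ h3))
      linarith

/-- The lower constant is the distance from `V⁽⁰⁾` of a fixed point `x₀` outside it: `ψ_w(x₀)` and a
vertex of `K_w` are then far enough apart. The upper constant `1` comes from the Lipschitz bounds.
-/
theorem isScalingDist_chainDist (hα : IsPolyratio α) (hd : IsDistance (F.chainDist α)) :
    F.IsScalingDist α (F.chainDist α) := by
  have h2 := F.two_le
  obtain ⟨x₀, hx₀⟩ := F.exists_notMem_V0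
  have hpos : ∀ j, 0 < F.chainDist α x₀ (F.bd j) := fun j =>
    (hd.nonneg _ _).lt_of_ne' fun h => hx₀ ⟨j, ((hd.eq_zero_iff _ _).1 h).symm⟩
  have : Nonempty (Fin N) := ⟨⟨0, by omega⟩⟩
  obtain ⟨j, hj⟩ := Finite.exists_min fun j => F.chainDist α x₀ (F.bd j)
  have h1 := chainDist_le_one (F := F) hα
  refine ⟨hd, ⟨1, h1⟩, F.chainDist α x₀ (F.bd j), 1, hpos j, one_pos, fun w => ⟨?_, ?_⟩⟩
  · have h3 : wordRatio α w * F.chainDist α x₀ (F.bd j) ≤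
        F.chainDist α (F.wmap w x₀) (F.wmap w (F.bd j)) :=
      le_chainDist fun t ht => ht.wordRatio_mul_le hα rfl ⟨_, ⟨j, rfl⟩, rfl⟩ (h1 _ _) hj
    have h4 : distDiam (F.chainDist α) Set.univ ≤ 1 :=
      distDiam_le ⟨x₀, trivial⟩ fun x _ y _ => h1 x y
    calc _ ≤ F.chainDist α x₀ (F.bd j) * wordRatio α w :=
          mul_le_of_le_one_right (mul_pos (hpos j) (hα.wordRatio_pos w)).le h4
      _ ≤ F.chainDist α (F.wmap w x₀) (F.wmap w (F.bd j)) := by rwa [mul_comm]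
      _ ≤ _ := le_distDiam (E := F.copy w) h1 ⟨_, rfl⟩ ⟨_, rfl⟩
  · rw [one_mul]
    refine distDiam_le ⟨_, x₀, rfl⟩ ?_
    rintro _ ⟨x, rfl⟩ _ ⟨y, rfl⟩
    exact (chainDist_wmap_le hα w x y).trans
      (mul_le_mul_of_nonneg_left (le_distDiam h1 trivial trivial) (hα.wordRatio_pos w).le)

theorem IsSelfSimilarDist.dist_wmap_le (hα : IsPolyratio α) {d : K → K → ℝ}
    (hd : F.IsSelfSimilarDist α d) (w : List (Fin k)) (x y : K) :
    d (F.wmap w x) (F.wmap w y) ≤ wordRatio α w * d x y := by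
  induction w with
  | nil => rw [wordRatio_nil, one_mul]; exact le_rfl
  | cons i w ih =>
    rw [wordRatio_cons, mul_assoc]
    exact (hd.2 i _ _).trans (mul_le_mul_of_nonneg_left ih (hα i).1.le)

end SelfSimilarFractal

theorem theorem6p3 {k N : ℕ} {K : Type u} [MetricSpace K] [CompactSpace K]
    (F : SelfSimilarFractal k N K) {r : ℕ} (Pi : Fin r → PointSeq K) (ι : Fin r → IndexPair N)
    (hi : F.CondI Pi ι) (hii : F.CondII ι) (hiii : F.CondIII Pi ι)
    (α : Fin k → ℝ) (hα : IsPolyratio α) :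
    (F.IsMetricPolyratio α ↔ ∀ s, 1 ≤ (Pi s).edgeSum (F.edgeRatio α)) ∧
      (F.IsAsMetricPolyratio α ↔ ∀ s, 1 ≤ (Pi s).edgeSum (F.edgeRatio α)) := by
  have hdist : (∀ s, 1 ≤ (Pi s).edgeSum (F.edgeRatio α)) → IsDistance (F.chainDist α) := by
    intro hsum
    obtain ⟨c, hc0, hc1, hc⟩ := hii.exists_le_edgeSum hα
      (hiii.one_le_edgeSum (fun s => (hi s).2.2.2.1) hα hsum)
    exact SelfSimilarFractal.isDistance_chainDist hα hc0 hc1 fun i j hij =>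
      SelfSimilarFractal.le_chainDist fun t ht => ht.le_of_forall_path hα hc hij
  refine ⟨⟨?_, fun h => ⟨_, hdist h, SelfSimilarFractal.chainDist_ψ_le hα⟩⟩,
    ⟨?_, fun h => ⟨_, SelfSimilarFractal.isScalingDist_chainDist hα (hdist h)⟩⟩⟩
  · rintro ⟨d, hd⟩ s
    refine SelfSimilarFractal.one_le_edgeSum_of_dist_le hα hd.1 (hi s).1 (hi s).2.2.2.2
      (C := d (F.bd (ι s).1.1) (F.bd (ι s).1.2)) fun w => ?_
    rw [mul_comm]
    exact hd.dist_wmap_le hα w _ _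
  · rintro ⟨d, hd, ⟨C, hC⟩, c₁, c₂, -, -, hw⟩ s
    refine SelfSimilarFractal.one_le_edgeSum_of_dist_le hα hd (hi s).1 (hi s).2.2.2.2
      -- Both end points lie in `K_w`, so the diameter bound controls their distance.
      (C := c₂ * distDiam d Set.univ) fun w => ?_
    rw [mul_right_comm]
    exact (le_distDiam (E := F.copy w) hC ⟨_, rfl⟩ ⟨_, rfl⟩).trans (hw w).2
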